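/- Let $1\le K\le N$, let $\mathbf\Phi,\mathbf\Delta\in\mathbb R^{M\times N}$, let $\mathbf\Psi\in\mathbb R^{N\times N}$ be invertible, let $\mathbf s\in\mathbb R^N$ be $K$-sparse (at most $K$ nonzero entries), and put $\mathbf x=\mathbf\Psi\mathbf s$, $\mathbf y=\mathbf\Phi\mathbf x$, where $\mathbf y\neq\mathbf 0$. Let $\tilde{\mathbf y}=\mathbf y+\mathbf e$ with $\mathbf e\in\mathbb R^M$, and put $\mathbf A=\mathbf\Phi\mathbf\Psi$, $\mathbf E=\mathbf\Delta\mathbf\Psi$, $\tilde{\mathbf A}=(\mathbf\Phi+\mathbf\Delta)\mathbf\Psi=\mathbf A+\mathbf E$. Write $\delta_k$ and $\tilde\delta_k$ for the restricted isometry constants of level $k$ of $\mathbf A$ and $\tilde{\mathbf A}$: $\delta_k$ is the smallest $\delta\ge 0$ with $(1-\delta)\|\mathbf v\|_2^2\le\|\mathbf A\mathbf v\|_2^2\le(1+\delta)\|\mathbf v\|_2^2$ for all $k$-sparse $\mathbf v$. Put $$\varepsilon_{\mathbf y}=\frac{\|\mathbf e\|_2}{\|\mathbf y\|_2},\qquad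 \varepsilon_{\mathbf A}^{(K)}=\frac{\|\mathbf E\|_2^{(K)}}{\|\mathbf A\|_2^{(K)}},\qquad \kappa_{\mathbf\Psi}=\|\mathbf\Psi\|_2\|\mathbf\Psi^{-1}\|_2,$$ where $\|\cdot\|_2$ of a matrix is the spectral norm and $\|\cdot\|_2^{(K)}$ is the largest spectral norm of a submatrix with $K$ columns. For a vector $\mathbf u$, let $\mathbf u_k$ denote a best $k$-term approximation in $\ell_2$ (ties broken arbitrarily), and for an index set $S$ let $\mathrm{LS}(S)$ be the vector that equals $\tilde{\mathbf A}_S^{\dagger}\tilde{\mathbf y}$ on $S$ and $0$ off $S$, where $\dagger$ is the Moore–Penrose pseudo-inverse and $\tilde{\mathbf A}_S$ consists of the columns indexed by $S$. Let $\mathbf s^{[0]},\mathbf s^{[1]},\dots$ be the iterates of one of the following algorithms run with $\tilde{\mathbf A}$, $\tilde{\mathbf y}$, $K$, where $\mathbf r^{l}=\tilde{\mathbf y}-\tilde{\mathbf A}\mathbf s^{[l]}$: * CoSaMP: $\mathbf s^{[0]}=\mathbf 0$ and $\mathbf s^{[l+1]}=\big(\mathrm{LS}(\mathrm{supp}((\tilde{\mathbf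 A}^T\mathbf r^l)_{2K})\cup\mathrm{supp}(\mathbf s^{[l]}))\big)_K$. * SP: $S^0=\mathrm{supp}((\tilde{\mathbf A}^T\tilde{\mathbf y})_K)$, $\mathbf s^{[l]}=\mathrm{LS}(S^l)$, and $S^{l+1}=\mathrm{supp}\big(\mathrm{LS}(\mathrm{supp}((\tilde{\mathbf A}^T\mathbf r^l)_K)\cup S^l)_K\big)$. * IHT: $\mathbf s^{[0]}=\mathbf 0$ and $\mathbf s^{[l+1]}=(\mathbf s^{[l]}+\tilde{\mathbf A}^T\mathbf r^l)_K$. Put $\mathbf x^{[l]}=\mathbf\Psi\mathbf s^{[l]}$, and let the constants be as follows, with $\delta=\tilde\delta_{bK}$. * CoSaMP: $a=1$, $b=4$, $c=0.171$, $\tilde C=\frac{4\delta}{(1-\delta)^2}$, $\tilde D=\frac{6+2\delta}{1-6\delta+\delta^2}$. * SP: $a=1.26$, $b=3$, $c=0.206$, $\tilde C=\frac{2\delta+2\delta^2}{(1-\delta)^3}$, $\tilde D=\frac{5-4\delta-8\delta^2-\delta^4}{1-6\delta+6\delta^2-2\delta^3+\delta^4}$. * IHT: $a=1$, $b=3$,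 $c=0.353$, $\tilde C=\sqrt8\,\delta$, $\tilde D=\frac{2\sqrt{1+\delta}}{1-\sqrt8\,\delta}$. If $\tilde\delta_{bK}\le c$, then for every $l\ge 0$ $$\frac{\|\mathbf x-\mathbf x^{[l]}\|_2}{\|\mathbf x\|_2}\le\kappa_{\mathbf\Psi}\Big(a\tilde C^{\,l}+\tilde D\sqrt{1+\delta_K}\,\big(\varepsilon_{\mathbf y}+\varepsilon_{\mathbf A}^{(K)}\big)\Big).$$ Furthermore, if $\varepsilon_{\mathbf y}+\varepsilon_{\mathbf A}^{(K)}>0$, then for every integer $l\ge 0$ with $$l\ge\left\lceil\log_{\tilde C}\left(\frac{\varepsilon_{\mathbf y}+\varepsilon_{\mathbf A}^{(K)}}{a}\right)\right\rceil$$ (for every $l\ge1$ if $\tilde C=0$, where the logarithm is undefined), $$\frac{\|\mathbf x-\mathbf x^{[l]}\|_2}{\|\mathbf x\|_2}\le\kappa_{\mathbf\Psi}\Big(\tilde D\sqrt{1+\delta_K}+1\Big)\big(\varepsilon_{\mathbf y}+\varepsilon_{\mathbf A}^{(K)}\big).$$ -/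

import Mathlib

open scoped Matrix
open scoped Matrix.Norms.L2Operator

noncomputable section

namespace Greedy

/-! ### Sparse vectors, best term approximations, restricted isometry constants -/

/-- The support of a vector, as a finite set of indices. -/
def supp {N : ℕ} (v : EuclideanSpace ℝ (Fin N)) : Finset (Fin N) :=
  Finset.univ.filter fun i => v i ≠ 0

/-- `v` has at most `k` nonzero entries. -/
def IsSparse {N : ℕ} (k : ℕ) (v : EuclideanSpace ℝ (Fin N)) : Prop :=
  (supp v).card ≤ k

/-- `v` is a best `k`-term approximation `u_k` of `u`. It need not be unique: entries of `u` may
have equal magnitudes. -/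
def IsBestApprox {N : ℕ} (k : ℕ) (u v : EuclideanSpace ℝ (Fin N)) : Prop :=
  IsSparse k v ∧ ∀ w : EuclideanSpace ℝ (Fin N), IsSparse k w → ‖u - v‖ ≤ ‖u - w‖

/-- The restricted isometry inequality of level `k` with constant `δ`. -/
def SatisfiesRIP {M N : ℕ} (A : Matrix (Fin M) (Fin N) ℝ) (k : ℕ) (δ : ℝ) : Prop :=
  ∀ v : EuclideanSpace ℝ (Fin N), IsSparse k v →
    (1 - δ) * ‖v‖ ^ 2 ≤ ‖Matrix.toEuclideanLin A v‖ ^ 2 ∧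
      ‖Matrix.toEuclideanLin A v‖ ^ 2 ≤ (1 + δ) * ‖v‖ ^ 2

/-- The restricted isometry constant of level `k`: the smallest nonnegative constant for which
the restricted isometry inequality of level `k` holds. -/
def ric {M N : ℕ} (A : Matrix (Fin M) (Fin N) ℝ) (k : ℕ) : ℝ :=
  sInf {δ : ℝ | 0 ≤ δ ∧ SatisfiesRIP A k δ}

/-- The infimum in the definition of `ric` is attained. -/
theorem ric_isLeast {M N : ℕ} (A : Matrix (Fin M) (Fin N) ℝ) (k : ℕ) :
    IsLeast {δ : ℝ | 0 ≤ δ ∧ SatisfiesRIP A k δ} (ric A k) := by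
  have hne : {δ : ℝ | 0 ≤ δ ∧ SatisfiesRIP A k δ}.Nonempty := by
    refine ⟨1 + ‖A‖ ^ 2, by positivity, fun v _ => ?_⟩
    have h : ‖Matrix.toEuclideanLin A v‖ ≤ ‖A‖ * ‖v‖ := Matrix.l2_opNorm_mulVec A v
    have h2 : ‖Matrix.toEuclideanLin A v‖ ^ 2 ≤ (‖A‖ * ‖v‖) ^ 2 := by gcongr
    rw [mul_pow] at h2
    constructor
    · nlinarith [sq_nonneg ‖Matrix.toEuclideanLin A v‖, sq_nonneg (‖A‖ * ‖v‖)]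
    · nlinarith [sq_nonneg ‖v‖]
  have hbdd : BddBelow {δ : ℝ | 0 ≤ δ ∧ SatisfiesRIP A k δ} := ⟨0, fun δ h => h.1⟩
  have hclosed : IsClosed {δ : ℝ | 0 ≤ δ ∧ SatisfiesRIP A k δ} := by
    simp only [SatisfiesRIP, Set.ofPred_and, Set.ofPred_forall]
    refine isClosed_Ici.inter (isClosed_iInter fun v => isClosed_iInter fun _ => ?_)
    exact (isClosed_le (by fun_prop) (by fun_prop)).inter
      (isClosed_le (by fun_prop) (by fun_prop))
  exact hclosed.isLeast_csInf hne hbdd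

/-! ### Norms, condition number -/

/-- The submatrix of `A` composed of the columns indexed by `S`. -/
def cols {M N : ℕ} (A : Matrix (Fin M) (Fin N) ℝ) (S : Finset (Fin N)) : Matrix (Fin M) S ℝ :=
  A.submatrix id Subtype.val

/-- The largest spectral norm over all submatrices of `A` with `k` columns. -/
def colNorm {M N : ℕ} (k : ℕ) (A : Matrix (Fin M) (Fin N) ℝ) : ℝ :=
  ⨆ S : {S : Finset (Fin N) // S.card = k}, ‖cols A S.1‖

/-- The condition number `‖Ψ‖ ‖Ψ⁻¹‖` in the spectral norm. -/
def condNumber {N : ℕ} (Ψ : Matrix (Fin N) (Fin N) ℝ) : ℝ :=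
  ‖Ψ‖ * ‖Ψ⁻¹‖

/-! ### The pseudo-inverse -/

/-- `X` is the Moore–Penrose pseudo-inverse of the real matrix `B`. -/
structure IsPseudoInverse {m n : Type*} [Fintype m] [Fintype n]
    (B : Matrix m n ℝ) (X : Matrix n m ℝ) : Prop where
  left : B * X * B = B
  right : X * B * X = X
  symm_left : (B * X)ᵀ = B * X
  symm_right : (X * B)ᵀ = X * B

theorem exists_isPseudoInverse {m n : Type*} [Fintype m] [Fintype n] (B : Matrix m n ℝ) :
    ∃ X : Matrix n m ℝ, IsPseudoInverse B X := by
  classical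
  have hG : (Bᵀ * B).IsHermitian := by
    simpa [Matrix.conjTranspose_eq_transpose_of_trivial] using
      Matrix.isHermitian_conjTranspose_mul_self B
  obtain ⟨P, hPt, hGPG, hPGP, hcomm⟩ : ∃ P : Matrix n n ℝ, Pᵀ = P ∧
      (Bᵀ * B) * P * (Bᵀ * B) = Bᵀ * B ∧ P * (Bᵀ * B) * P = P ∧
      (Bᵀ * B) * P = P * (Bᵀ * B) := by
    obtain ⟨U, V, d, hVU, hV, hdec⟩ : ∃ (U V : Matrix n n ℝ) (d : n → ℝ), V * U = 1 ∧ V = Uᵀ ∧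
        Bᵀ * B = U * Matrix.diagonal d * V := by
      refine ⟨hG.eigenvectorUnitary, star (hG.eigenvectorUnitary : Matrix n n ℝ),
        hG.eigenvalues, ?_, ?_, ?_⟩
      · exact Unitary.coe_star_mul_self hG.eigenvectorUnitary
      · rw [Matrix.star_eq_conjTranspose, Matrix.conjTranspose_eq_transpose_of_trivial]
      · conv_lhs => rw [hG.spectral_theorem, Unitary.conjStarAlgAut_apply]
        rfl
    have key : ∀ f g : n → ℝ, (U * Matrix.diagonal f * V) * (U * Matrix.diagonal g * V) =
        U * Matrix.diagonal (fun i => f i * g i) * V := by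
      intro f g
      calc _ = U * Matrix.diagonal f * (V * U) * Matrix.diagonal g * V := by
              simp only [Matrix.mul_assoc]
        _ = _ := by
              rw [hVU, Matrix.mul_one, Matrix.mul_assoc U, Matrix.diagonal_mul_diagonal]
    refine ⟨U * Matrix.diagonal (fun i => (d i)⁻¹) * V, ?_, ?_, ?_, ?_⟩
    · subst hV
      simp [Matrix.transpose_mul, Matrix.mul_assoc]
    · rw [hdec, key, key]
      congr 3
      ext i
      by_cases h : d i = 0 <;> simp [h]
    · rw [hdec, key, key]
      congr 3
      ext i
      by_cases h : d i = 0 <;> simp [h]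
    · rw [hdec, key, key]
      congr 3
      ext i
      ring
  refine ⟨P * Bᵀ, ?_, ?_, ?_, ?_⟩
  · have h0 : (B * P * (Bᵀ * B) - B)ᵀ * (B * P * (Bᵀ * B) - B) = 0 := by
      have h1 : (Bᵀ * B) * (P * (Bᵀ * B)) = Bᵀ * B := by rw [← Matrix.mul_assoc, hGPG]
      have h2 : (B * P * (Bᵀ * B) - B)ᵀ = (Bᵀ * B) * P * Bᵀ - Bᵀ := by
        simp [Matrix.transpose_mul, hPt, Matrix.mul_assoc]
      have h3 : Bᵀ * (B * P * (Bᵀ * B) - B) = 0 := by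
        rw [Matrix.mul_sub, sub_eq_zero]
        simpa only [Matrix.mul_assoc] using h1
      rw [h2, Matrix.sub_mul, Matrix.mul_assoc, h3, Matrix.mul_zero, sub_zero]
    have h1 : B * P * (Bᵀ * B) - B = 0 := by
      rw [← Matrix.conjTranspose_mul_self_eq_zero, Matrix.conjTranspose_eq_transpose_of_trivial]
      exact h0
    simpa only [Matrix.mul_assoc] using sub_eq_zero.1 h1
  · calc P * Bᵀ * B * (P * Bᵀ) = P * (Bᵀ * B) * P * Bᵀ := by simp only [Matrix.mul_assoc]
      _ = _ := by rw [hPGP]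
  · simp [Matrix.transpose_mul, hPt, Matrix.mul_assoc]
  · have : P * Bᵀ * B = P * (Bᵀ * B) := Matrix.mul_assoc _ _ _
    rw [this, Matrix.transpose_mul, hPt, ← hcomm]
    simp [Matrix.transpose_mul]

/-- The Moore–Penrose pseudo-inverse of a real matrix. -/
def pinv {m n : Type*} [Fintype m] [Fintype n] (B : Matrix m n ℝ) : Matrix n m ℝ :=
  Classical.choose (exists_isPseudoInverse B)

theorem pinv_spec {m n : Type*} [Fintype m] [Fintype n] (B : Matrix m n ℝ) :
    IsPseudoInverse B (pinv B) :=
  Classical.choose_spec (exists_isPseudoInverse B)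

/-- The vector `b` with `b_S = A_S† y` and with zero entries outside `S`. -/
def lsOn {M N : ℕ} (A : Matrix (Fin M) (Fin N) ℝ) (S : Finset (Fin N))
    (y : EuclideanSpace ℝ (Fin M)) : EuclideanSpace ℝ (Fin N) :=
  WithLp.toLp 2 fun i => if h : i ∈ S then (pinv (cols A S) *ᵥ y.ofLp) ⟨i, h⟩ else 0

/-! ### The three algorithms

Each algorithm is described by the property that a sequence `z 0, z 1, z 2, …` is the sequence of
its iterates `s^[0], s^[1], s^[2], …` on the sensing matrix `A`, the measurement vector `y` and the
sparsity level `K`, for some way of choosing the best term approximations in case of ties. -/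

/-- The iterates of compressive sampling matching pursuit. -/
def IsCoSaMPRun {M N : ℕ} (A : Matrix (Fin M) (Fin N) ℝ) (y : EuclideanSpace ℝ (Fin M)) (K : ℕ)
    (z : ℕ → EuclideanSpace ℝ (Fin N)) : Prop :=
  z 0 = 0 ∧
    ∀ l : ℕ, ∃ w : EuclideanSpace ℝ (Fin N),
      IsBestApprox (2 * K)
        (Matrix.toEuclideanLin Aᵀ (y - Matrix.toEuclideanLin A (z l))) w ∧
      IsBestApprox K (lsOn A (supp w ∪ supp (z l)) y) (z (l + 1))

/-- The iterates of subspace pursuit; `S l` is the support estimate after `l` iterations. -/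
def IsSPRun {M N : ℕ} (A : Matrix (Fin M) (Fin N) ℝ) (y : EuclideanSpace ℝ (Fin M)) (K : ℕ)
    (z : ℕ → EuclideanSpace ℝ (Fin N)) : Prop :=
  ∃ S : ℕ → Finset (Fin N),
    (∃ w : EuclideanSpace ℝ (Fin N),
      IsBestApprox K (Matrix.toEuclideanLin Aᵀ y) w ∧ S 0 = supp w) ∧
    (∀ l : ℕ, z l = lsOn A (S l) y) ∧
    ∀ l : ℕ, ∃ w p : EuclideanSpace ℝ (Fin N),
      IsBestApprox K (Matrix.toEuclideanLin Aᵀ (y - Matrix.toEuclideanLin A (z l))) w ∧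
      IsBestApprox K (lsOn A (supp w ∪ S l) y) p ∧ S (l + 1) = supp p

/-- The iterates of iterative hard thresholding. -/
def IsIHTRun {M N : ℕ} (A : Matrix (Fin M) (Fin N) ℝ) (y : EuclideanSpace ℝ (Fin M)) (K : ℕ)
    (z : ℕ → EuclideanSpace ℝ (Fin N)) : Prop :=
  z 0 = 0 ∧
    ∀ l : ℕ, IsBestApprox K
      (z l + Matrix.toEuclideanLin Aᵀ (y - Matrix.toEuclideanLin A (z l))) (z (l + 1))

/-- The greedy pursuits with replacement. -/
inductive Pursuit
  | CoSaMP
  | SP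
  | IHT

namespace Pursuit

/-- `z` is the sequence of iterates of the algorithm. -/
def IsRun {M N : ℕ} : Pursuit → Matrix (Fin M) (Fin N) ℝ → EuclideanSpace ℝ (Fin M) → ℕ →
    (ℕ → EuclideanSpace ℝ (Fin N)) → Prop
  | CoSaMP => IsCoSaMPRun
  | SP => IsSPRun
  | IHT => IsIHTRun

/-- The constant `a`. -/
def a : Pursuit → ℝ
  | CoSaMP => 1
  | SP => 1.26
  | IHT => 1

/-- The constant `b`. -/
def b : Pursuit → ℕ
  | CoSaMP => 4
  | SP => 3
  | IHT => 3

/-- The constant `c`. -/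
def c : Pursuit → ℝ
  | CoSaMP => 0.171
  | SP => 0.206
  | IHT => 0.353

/-- The constant `C` as a function of the restricted isometry constant `δ` of level `b K`. -/
def C : Pursuit → ℝ → ℝ
  | CoSaMP, δ => 4 * δ / (1 - δ) ^ 2
  | SP, δ => (2 * δ + 2 * δ ^ 2) / (1 - δ) ^ 3
  | IHT, δ => √8 * δ

/-- The constant `D` as a function of the restricted isometry constant `δ` of level `b K`. -/
def D : Pursuit → ℝ → ℝ
  | CoSaMP, δ => (6 + 2 * δ) / (1 - 6 * δ + δ ^ 2)
  | SP, δ => (5 - 4 * δ - 8 * δ ^ 2 - δ ^ 4) / (1 - 6 * δ + 6 * δ ^ 2 - 2 * δ ^ 3 + δ ^ 4)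
  | IHT, δ => 2 * √(1 + δ) / (1 - √8 * δ)

end Pursuit

end Greedy

end

open Greedy

open Matrix (toEuclideanLin)

namespace Greedy

/-! The matrix perturbation is read as measurement noise: `y + e = A' s + n` with `n = e - E s`.
Since `s` is `K`-sparse, `‖y‖ ≤ √(1 + δ) ‖s‖` and `‖E s‖ ≤ εA ‖A‖^(K) ‖s‖ ≤ εA √(1 + δ) ‖s‖`, so
`‖n‖ ≤ √(1 + δ) (εy + εA) ‖s‖`. It remains to prove stability under additive noise, `‖s - z l‖ ≤ a C
^ l ‖s‖ + D ‖n‖` (`Pursuit.norm_sub_le`), and to pass from `s` to `x = Ψ s`, which costs the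
condition number.

Stability comes from a one-step contraction. On sparse vectors `Aᵀ A` is nearly the identity
(`SatisfiesRIP.abs_inner_sub_le`), so the proxy `Aᵀ (A r + n)` approximates `r` on small index sets.
For IHT this bounds the next error directly. For CoSaMP and SP it shows that the largest proxy
entries miss little of `r` (`SatisfiesRIP.norm_restr_sdiff_le`); least squares on the merged support
has error controlled by the missed part of `s` (`SatisfiesRIP.norm_sub_lsOn_le`), and pruning to `K`
terms loses a bounded factor. In SP the contracting quantity is the part of `s` outside the support
estimate, not the error itself. A geometric recursion then sums the noise. -/

/-! ### Restrictions of vectors to index sets -/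

/-- The vector that agrees with `v` on `S` and vanishes outside `S`. -/
def restr {N : ℕ} (S : Finset (Fin N)) (v : EuclideanSpace ℝ (Fin N)) :
    EuclideanSpace ℝ (Fin N) :=
  WithLp.toLp 2 fun i => if i ∈ S then v i else 0

section Restr

variable {N : ℕ}

@[simp]
theorem restr_apply (S : Finset (Fin N)) (v : EuclideanSpace ℝ (Fin N)) (i : Fin N) :
    restr S v i = if i ∈ S then v i else 0 := rfl

@[simp]
theorem mem_supp {v : EuclideanSpace ℝ (Fin N)} {i : Fin N} : i ∈ supp v ↔ v i ≠ 0 := by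
  simp [supp]

theorem supp_subset_iff {v : EuclideanSpace ℝ (Fin N)} {S : Finset (Fin N)} :
    supp v ⊆ S ↔ ∀ i, i ∉ S → v i = 0 := by
  simp only [Finset.subset_iff, mem_supp, ne_eq]
  exact forall_congr' fun i => not_imp_comm

theorem IsSparse.of_subset {k : ℕ} {v : EuclideanSpace ℝ (Fin N)} {U : Finset (Fin N)}
    (h : supp v ⊆ U) (hU : U.card ≤ k) : IsSparse k v :=
  (Finset.card_le_card h).trans hU

theorem supp_restr_subset (S : Finset (Fin N)) (v : EuclideanSpace ℝ (Fin N)) :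
    supp (restr S v) ⊆ S :=
  supp_subset_iff.2 fun i hi => by simp [hi]

theorem supp_restr_subset_supp (S : Finset (Fin N)) (v : EuclideanSpace ℝ (Fin N)) :
    supp (restr S v) ⊆ supp v :=
  supp_subset_iff.2 fun i hi => by
    simp only [mem_supp, ne_eq, not_not] at hi
    simp [hi]

theorem supp_sub_subset {u v : EuclideanSpace ℝ (Fin N)} {S : Finset (Fin N)}
    (hu : supp u ⊆ S) (hv : supp v ⊆ S) : supp (u - v) ⊆ S := by
  rw [supp_subset_iff] at *
  intro i hi
  simp [hu i hi, hv i hi]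

theorem supp_add_subset {u v : EuclideanSpace ℝ (Fin N)} {S : Finset (Fin N)}
    (hu : supp u ⊆ S) (hv : supp v ⊆ S) : supp (u + v) ⊆ S := by
  rw [supp_subset_iff] at *
  intro i hi
  simp [hu i hi, hv i hi]

theorem supp_smul_subset {v : EuclideanSpace ℝ (Fin N)} {S : Finset (Fin N)} (c : ℝ)
    (hv : supp v ⊆ S) : supp (c • v) ⊆ S := by
  rw [supp_subset_iff] at *
  intro i hi
  simp [hv i hi]

theorem restr_of_supp_subset {S : Finset (Fin N)} {v : EuclideanSpace ℝ (Fin N)}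
    (h : supp v ⊆ S) : restr S v = v := by
  ext i
  by_cases hi : i ∈ S
  · simp [hi]
  · simp [hi, supp_subset_iff.1 h i hi]

theorem restr_sub (S : Finset (Fin N)) (u v : EuclideanSpace ℝ (Fin N)) :
    restr S (u - v) = restr S u - restr S v := by
  ext i
  by_cases hi : i ∈ S <;> simp [hi]

theorem restr_add_restr_compl (S : Finset (Fin N)) (v : EuclideanSpace ℝ (Fin N)) :
    restr S v + restr Sᶜ v = v := by
  ext i
  by_cases hi : i ∈ S <;> simp [hi]

theorem norm_restr_sq (S : Finset (Fin N)) (v : EuclideanSpace ℝ (Fin N)) :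
    ‖restr S v‖ ^ 2 = ∑ i ∈ S, v i ^ 2 := by
  rw [EuclideanSpace.real_norm_sq_eq]
  simp [Finset.sum_ite_mem, ite_pow]

theorem inner_restr_self (S : Finset (Fin N)) (v : EuclideanSpace ℝ (Fin N)) :
    inner ℝ v (restr S v) = ‖restr S v‖ ^ 2 := by
  rw [norm_restr_sq, PiLp.inner_apply]
  simp [Finset.sum_ite_mem, sq]

theorem norm_restr_mono {S T : Finset (Fin N)} (h : S ⊆ T) (v : EuclideanSpace ℝ (Fin N)) :
    ‖restr S v‖ ≤ ‖restr T v‖ := by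
  rw [← sq_le_sq₀ (norm_nonneg _) (norm_nonneg _), norm_restr_sq, norm_restr_sq]
  exact Finset.sum_le_sum_of_subset_of_nonneg h fun i _ _ => sq_nonneg _

theorem norm_restr_le (S : Finset (Fin N)) (v : EuclideanSpace ℝ (Fin N)) :
    ‖restr S v‖ ≤ ‖v‖ := by
  have h := norm_restr_mono (Finset.subset_univ S) v
  rwa [restr_of_supp_subset (Finset.subset_univ (supp v))] at h

theorem norm_sq_eq_restr_add (S : Finset (Fin N)) (v : EuclideanSpace ℝ (Fin N)) :
    ‖v‖ ^ 2 = ‖restr S v‖ ^ 2 + ‖restr Sᶜ v‖ ^ 2 := by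
  rw [norm_restr_sq, norm_restr_sq, EuclideanSpace.real_norm_sq_eq, Finset.sum_add_sum_compl]

/-! ### Best term approximations -/

theorem sub_restr (S : Finset (Fin N)) (v : EuclideanSpace ℝ (Fin N)) :
    v - restr S v = restr Sᶜ v :=
  sub_eq_of_eq_add' (restr_add_restr_compl S v).symm

variable {k : ℕ} {u v : EuclideanSpace ℝ (Fin N)}

/-- The restriction of `u` to `supp v` competes with `v`; by Pythagoras, optimality forces the error
of `v` on its own support to vanish. -/
theorem IsBestApprox.restr_supp (h : IsBestApprox k u v) : restr (supp v) u = v := by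
  have h1 := h.2 (restr (supp v) u) (IsSparse.of_subset (supp_restr_subset _ _) h.1)
  rw [sub_restr] at h1
  have h2 := norm_sq_eq_restr_add (supp v) (u - v)
  have h3 : restr (supp v)ᶜ (u - v) = restr (supp v)ᶜ u := by
    ext i
    by_cases hi : v i = 0 <;> simp [hi]
  rw [h3] at h2
  have h4 : ‖restr (supp v) (u - v)‖ = 0 := by
    have : ‖u - v‖ ^ 2 ≤ ‖restr (supp v)ᶜ u‖ ^ 2 := by gcongr
    exact pow_eq_zero_iff two_ne_zero |>.1 (le_antisymm (by linarith) (sq_nonneg _))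
  rw [norm_eq_zero, restr_sub, restr_of_supp_subset (subset_refl (supp v)), sub_eq_zero] at h4
  exact h4

theorem IsBestApprox.apply_eq (h : IsBestApprox k u v) {i : Fin N} (hi : i ∈ supp v) :
    u i = v i := by
  conv_rhs => rw [← h.restr_supp]
  simp only [restr_apply, hi, if_true]

/-- A best term approximation selects at least as much energy as any index set of the same size. -/
theorem IsBestApprox.norm_restr_sdiff_le (h : IsBestApprox k u v) {R : Finset (Fin N)}
    (hR : R.card ≤ k) : ‖restr (R \ supp v) u‖ ≤ ‖restr (supp v \ R) u‖ := by
  have h1 := h.2 (restr R u) (IsSparse.of_subset (supp_restr_subset _ _) hR)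
  have h2 : u - v = restr (supp v)ᶜ u := by
    conv_lhs => rw [← h.restr_supp]
    exact sub_restr _ _
  rw [sub_restr, h2, ← sq_le_sq₀ (norm_nonneg _) (norm_nonneg _)] at h1
  rw [← sq_le_sq₀ (norm_nonneg _) (norm_nonneg _)]
  have h3 := norm_sq_eq_restr_add (supp v) u
  have h4 := norm_sq_eq_restr_add R u
  simp only [norm_restr_sq] at *
  have h5 := Finset.sum_sdiff_sub_sum_sdiff (s₁ := supp v) (s₂ := R) (f := fun i => u i ^ 2)
  linarith

end Restr

/-! ### Consequences of the restricted isometry property -/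

section RIP

variable {M N : ℕ} {A : Matrix (Fin M) (Fin N) ℝ}

theorem inner_toEuclideanLin_transpose (u : EuclideanSpace ℝ (Fin M))
    (v : EuclideanSpace ℝ (Fin N)) :
    inner ℝ (toEuclideanLin Aᵀ u) v = inner ℝ u (toEuclideanLin A v) := by
  rw [← Matrix.conjTranspose_eq_transpose_of_trivial, Matrix.toEuclideanLin_conjTranspose_eq_adjoint,
    LinearMap.adjoint_inner_left]

variable {k : ℕ} {δ : ℝ}

theorem SatisfiesRIP.norm_le (h : SatisfiesRIP A k δ) (hδ : 0 ≤ δ)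
    {v : EuclideanSpace ℝ (Fin N)} (hv : IsSparse k v) :
    ‖toEuclideanLin A v‖ ≤ √(1 + δ) * ‖v‖ := by
  rw [← sq_le_sq₀ (norm_nonneg _) (by positivity), mul_pow, Real.sq_sqrt (by positivity)]
  exact (h v hv).2

/-- Vectors with small joint support are nearly as orthogonal after multiplication by `A`. -/
theorem SatisfiesRIP.abs_inner_sub_le (h : SatisfiesRIP A k δ)
    {U : Finset (Fin N)} (hU : U.card ≤ k) {u v : EuclideanSpace ℝ (Fin N)}
    (hu : supp u ⊆ U) (hv : supp v ⊆ U) :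
    |inner ℝ (toEuclideanLin A u) (toEuclideanLin A v) - inner ℝ u v| ≤ δ * ‖u‖ * ‖v‖ := by
  -- Polarization: the deviation is at most `δ (‖u + v‖² + ‖u - v‖²) / 4`, which equals `δ` for unit
  -- vectors. Normalizing first gives the product `‖u‖ ‖v‖` in general.
  have unit : ∀ u v : EuclideanSpace ℝ (Fin N), supp u ⊆ U → supp v ⊆ U → ‖u‖ = 1 → ‖v‖ = 1 →
      |inner ℝ (toEuclideanLin A u) (toEuclideanLin A v) - inner ℝ u v| ≤ δ := by
    intro u v hu hv nu nv
    have hp := h (u + v) (IsSparse.of_subset (supp_add_subset hu hv) hU)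
    have hm := h (u - v) (IsSparse.of_subset (supp_sub_subset hu hv) hU)
    rw [map_add, norm_add_sq_real, norm_add_sq_real, nu, nv] at hp
    rw [map_sub, norm_sub_sq_real, norm_sub_sq_real, nu, nv] at hm
    rw [abs_le]
    constructor <;> linarith [hp.1, hp.2, hm.1, hm.2]
  rcases eq_or_ne u 0 with rfl | hu0
  · simp
  rcases eq_or_ne v 0 with rfl | hv0
  · simp
  have nu : 0 < ‖u‖ := norm_pos_iff.2 hu0
  have nv : 0 < ‖v‖ := norm_pos_iff.2 hv0
  have := unit (‖u‖⁻¹ • u) (‖v‖⁻¹ • v) (supp_smul_subset _ hu) (supp_smul_subset _ hv)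
    (norm_smul_inv_norm hu0) (norm_smul_inv_norm hv0)
  simp only [map_smul, real_inner_smul_left, real_inner_smul_right] at this
  rw [← mul_sub, ← mul_sub, abs_mul, abs_mul, abs_of_pos (inv_pos.2 nu),
    abs_of_pos (inv_pos.2 nv)] at this
  calc _ = (‖u‖⁻¹ * (‖v‖⁻¹ * |inner ℝ (toEuclideanLin A u) (toEuclideanLin A v) - inner ℝ u v|))
        * (‖u‖ * ‖v‖) := by field_simp
    _ ≤ δ * (‖u‖ * ‖v‖) := by
      rw [mul_left_comm] at this
      gcongr
    _ = _ := by ring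

variable {U : Finset (Fin N)} {n : EuclideanSpace ℝ (Fin M)}

/-- The proxy `Aᵀ (A r + n)` is close to `r` in the inner product with sparse vectors. -/
theorem SatisfiesRIP.inner_proxy_sub_le (h : SatisfiesRIP A k δ) (hδ : 0 ≤ δ) (hU : U.card ≤ k)
    {r q : EuclideanSpace ℝ (Fin N)} (hr : supp r ⊆ U) (hq : supp q ⊆ U) :
    inner ℝ (toEuclideanLin Aᵀ (toEuclideanLin A r + n) - r) q ≤
      (δ * ‖r‖ + √(1 + δ) * ‖n‖) * ‖q‖ := by
  rw [inner_sub_left, inner_toEuclideanLin_transpose, inner_add_left]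
  have h1 := (abs_le.1 (h.abs_inner_sub_le hU hr hq)).2
  have h2 : inner ℝ n (toEuclideanLin A q) ≤ ‖n‖ * (√(1 + δ) * ‖q‖) :=
    (real_inner_le_norm _ _).trans
      (by gcongr; exact h.norm_le hδ (IsSparse.of_subset hq hU))
  linarith

/-- Test the inner product bound against the restricted proxy error itself and divide by its norm.
-/
theorem SatisfiesRIP.norm_restr_proxy_sub_le (h : SatisfiesRIP A k δ) (hδ : 0 ≤ δ)
    (hU : U.card ≤ k) {r : EuclideanSpace ℝ (Fin N)} (hr : supp r ⊆ U) {J : Finset (Fin N)}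
    (hJ : J ⊆ U) :
    ‖restr J (toEuclideanLin Aᵀ (toEuclideanLin A r + n) - r)‖ ≤
      δ * ‖r‖ + √(1 + δ) * ‖n‖ := by
  have h1 := h.inner_proxy_sub_le (n := n) hδ hU hr ((supp_restr_subset J
    (toEuclideanLin Aᵀ (toEuclideanLin A r + n) - r)).trans hJ)
  rw [inner_restr_self, sq] at h1
  rcases (norm_nonneg (restr J (toEuclideanLin Aᵀ (toEuclideanLin A r + n) - r))).eq_or_lt
    with h0 | h0
  · rw [← h0]
    positivity
  · exact le_of_mul_le_mul_right h1 h0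

/-- The largest entries of the proxy capture most of the energy of `r`. -/
theorem SatisfiesRIP.norm_restr_sdiff_le (h : SatisfiesRIP A k δ) (hδ : 0 ≤ δ)
    (hU : U.card ≤ k) {r w : EuclideanSpace ℝ (Fin N)} (hr : supp r ⊆ U)
    {R : Finset (Fin N)} (hRU : R ⊆ U) (hwU : supp w ⊆ U) {m : ℕ} (hR : R.card ≤ m)
    (hw : IsBestApprox m (toEuclideanLin Aᵀ (toEuclideanLin A r + n)) w)
    (hrw : ∀ i ∈ supp w, i ∉ R → r i = 0) :
    ‖restr (R \ supp w) r‖ ≤ 2 * (δ * ‖r‖ + √(1 + δ) * ‖n‖) := by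
  have h1 := h.norm_restr_proxy_sub_le (n := n) hδ hU hr (Finset.sdiff_subset.trans hRU)
    (J := R \ supp w)
  have h2 := h.norm_restr_proxy_sub_le (n := n) hδ hU hr (Finset.sdiff_subset.trans hwU)
    (J := supp w \ R)
  have h3 := hw.norm_restr_sdiff_le hR
  -- On `supp w \ R` the proxy is pure error, and it dominates the proxy on `R \ supp w`. The two
  -- proxy errors give the factor 2.
  have h4 : restr (supp w \ R) r = 0 := by
    ext i
    by_cases hi : i ∈ supp w \ R
    · rw [Finset.mem_sdiff] at hi
      simp [hrw i hi.1 hi.2]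
    · simp only [restr_apply, hi, if_false]
      rfl
  rw [restr_sub, h4, sub_zero] at h2
  rw [restr_sub] at h1
  have h5 := norm_sub_norm_le (restr (R \ supp w) r)
    (restr (R \ supp w) (toEuclideanLin Aᵀ (toEuclideanLin A r + n)))
  rw [norm_sub_rev] at h5
  linarith

end RIP

/-! ### Least squares -/

section LeastSquares

variable {M N : ℕ} {A : Matrix (Fin M) (Fin N) ℝ}

theorem lsOn_apply_of_notMem {S : Finset (Fin N)} {y : EuclideanSpace ℝ (Fin M)} {i : Fin N}
    (hi : i ∉ S) : lsOn A S y i = 0 := by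
  simp [lsOn, hi]

theorem supp_lsOn_subset (S : Finset (Fin N)) (y : EuclideanSpace ℝ (Fin M)) :
    supp (lsOn A S y) ⊆ S :=
  supp_subset_iff.2 fun _ => lsOn_apply_of_notMem

theorem mulVec_eq_cols_mulVec {S : Finset (Fin N)} {v : EuclideanSpace ℝ (Fin N)}
    (hv : supp v ⊆ S) : A *ᵥ v.ofLp = cols A S *ᵥ fun i : S => v i := by
  ext j
  simp only [Matrix.mulVec, dotProduct, cols, Matrix.submatrix_apply, id]
  rw [Finset.sum_coe_sort S fun i => A j i * v i]
  exact (Finset.sum_subset (Finset.subset_univ S) fun i _ hi => by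
    rw [supp_subset_iff.1 hv i hi, mul_zero]).symm

/-- The residual of the least squares solution is orthogonal to the selected columns. -/
theorem transpose_residual_lsOn_apply {S : Finset (Fin N)} (y : EuclideanSpace ℝ (Fin M))
    {i : Fin N} (hi : i ∈ S) :
    toEuclideanLin Aᵀ (y - toEuclideanLin A (lsOn A S y)) i = 0 := by
  have hb : A *ᵥ (lsOn A S y).ofLp = cols A S *ᵥ (pinv (cols A S) *ᵥ y.ofLp) := by
    rw [mulVec_eq_cols_mulVec (supp_lsOn_subset S y)]
    congr 1
    ext j
    simp [lsOn]
  have hX := pinv_spec (cols A S)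
  -- The normal equations follow from two Penrose identities alone, so the selected columns may be
  -- linearly dependent.
  have ht : (cols A S)ᵀ * (cols A S * pinv (cols A S)) = (cols A S)ᵀ := by
    conv_rhs => rw [← hX.left]
    rw [Matrix.transpose_mul, hX.symm_left]
  have h0 : (cols A S)ᵀ *ᵥ (y.ofLp - A *ᵥ (lsOn A S y).ofLp) = 0 := by
    rw [hb, Matrix.mulVec_sub, Matrix.mulVec_mulVec, Matrix.mulVec_mulVec, Matrix.mul_assoc,
      ht, sub_self]
  exact congrFun h0 ⟨i, hi⟩

theorem inner_residual_lsOn {S : Finset (Fin N)} (y : EuclideanSpace ℝ (Fin M))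
    {d : EuclideanSpace ℝ (Fin N)} (hd : supp d ⊆ S) :
    inner ℝ (y - toEuclideanLin A (lsOn A S y)) (toEuclideanLin A d) = 0 := by
  rw [← inner_toEuclideanLin_transpose, PiLp.inner_apply]
  refine Finset.sum_eq_zero fun i _ => ?_
  by_cases hi : i ∈ S
  · rw [transpose_residual_lsOn_apply y hi, inner_zero_left]
  · rw [supp_subset_iff.1 hd i hi, inner_zero_right]

variable {k : ℕ} {δ : ℝ} {s : EuclideanSpace ℝ (Fin N)} {n : EuclideanSpace ℝ (Fin M)}

/-- With `d` the error on `T`, the residual `A d + A (restr Tᶜ s) + n` is orthogonal to `A d`. The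
restricted isometry bounds `‖A d‖²` from below, and the cross term is small because `d` and `restr
Tᶜ s` have disjoint supports. -/
theorem SatisfiesRIP.norm_restr_sub_lsOn_le (h : SatisfiesRIP A k δ) (hδ : 0 ≤ δ)
    {T : Finset (Fin N)} (hT : (supp s ∪ T).card ≤ k) :
    (1 - δ) * ‖restr T s - lsOn A T (toEuclideanLin A s + n)‖ ≤
      δ * ‖restr Tᶜ s‖ + √(1 + δ) * ‖n‖ := by
  set b := lsOn A T (toEuclideanLin A s + n) with hb
  set d := restr T s - b with hd
  have hdT : supp d ⊆ T := supp_sub_subset (supp_restr_subset _ _) (supp_lsOn_subset _ _)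
  have hdU : supp d ⊆ supp s ∪ T := hdT.trans Finset.subset_union_right
  have hcU : supp (restr Tᶜ s) ⊆ supp s ∪ T :=
    (supp_restr_subset_supp _ _).trans Finset.subset_union_left
  have h0 : inner ℝ (toEuclideanLin A d + (toEuclideanLin A (restr Tᶜ s) + n))
      (toEuclideanLin A d) = 0 := by
    rw [← inner_residual_lsOn (A := A) (toEuclideanLin A s + n) hdT]
    congr 1
    have hs : toEuclideanLin A s = toEuclideanLin A (restr T s) + toEuclideanLin A (restr Tᶜ s) := by
      rw [← map_add, restr_add_restr_compl]
    rw [← hb, hs, hd, map_sub]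
    abel
  rw [inner_add_left, inner_add_left, real_inner_self_eq_norm_sq] at h0
  have h1 := (h d (IsSparse.of_subset hdU hT)).1
  have h2 := (abs_le.1 (h.abs_inner_sub_le hT hcU hdU)).1
  have h3 : inner ℝ (restr Tᶜ s) d = 0 := by
    rw [PiLp.inner_apply]
    refine Finset.sum_eq_zero fun i _ => ?_
    by_cases hi : i ∈ T
    · simp [hi]
    · rw [supp_subset_iff.1 hdT i hi, inner_zero_right]
  have h4 : -inner ℝ n (toEuclideanLin A d) ≤ ‖n‖ * (√(1 + δ) * ‖d‖) := by
    rw [← inner_neg_left]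
    refine (real_inner_le_norm _ _).trans ?_
    rw [norm_neg]
    gcongr
    exact h.norm_le hδ (IsSparse.of_subset hdU hT)
  rcases (norm_nonneg d).eq_or_lt with h5 | h5
  · rw [← h5, mul_zero]
    positivity
  · refine le_of_mul_le_mul_right ?_ h5
    nlinarith

theorem SatisfiesRIP.norm_sub_lsOn_le (h : SatisfiesRIP A k δ) (hδ : 0 ≤ δ) (hδ1 : δ < 1)
    {T : Finset (Fin N)} (hT : (supp s ∪ T).card ≤ k) :
    (1 - δ) * ‖s - lsOn A T (toEuclideanLin A s + n)‖ ≤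
      ‖restr Tᶜ s‖ + √(1 + δ) * ‖n‖ := by
  have h1 := h.norm_restr_sub_lsOn_le (n := n) hδ hT
  have h2 := norm_add_le (restr Tᶜ s) (restr T s - lsOn A T (toEuclideanLin A s + n))
  rw [← add_sub_assoc, add_comm (restr Tᶜ s), restr_add_restr_compl] at h2
  -- The coefficients of the missed part add up to `(1 - δ) + δ = 1`.
  nlinarith

end LeastSquares

/-! ### One iteration of each algorithm -/

section Steps

variable {M N : ℕ} {A : Matrix (Fin M) (Fin N) ℝ} {K : ℕ} {δ : ℝ}
  {s : EuclideanSpace ℝ (Fin N)} {n : EuclideanSpace ℝ (Fin M)}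
  {z : ℕ → EuclideanSpace ℝ (Fin N)}

theorem norm_restr_le_norm_restr {S T : Finset (Fin N)} {u v : EuclideanSpace ℝ (Fin N)}
    (h : ∀ i ∈ S, u i ≠ 0 → i ∈ T ∧ u i = v i) : ‖restr S u‖ ≤ ‖restr T v‖ := by
  rw [← sq_le_sq₀ (norm_nonneg _) (norm_nonneg _), norm_restr_sq, norm_restr_sq,
    ← Finset.sum_filter_of_ne (p := fun i => u i ≠ 0) fun i _ hi h0 => hi (by simp [h0])]
  refine (Finset.sum_le_sum fun i hi => ?_).trans
    (Finset.sum_le_sum_of_subset_of_nonneg (f := fun i => v i ^ 2) (t := T) (fun i hi => ?_)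
      fun i _ _ => sq_nonneg _)
  · rw [Finset.mem_filter] at hi
    rw [(h i hi.1 hi.2).2]
  · rw [Finset.mem_filter] at hi
    exact (h i hi.1 hi.2).1

theorem isSparse_zero (k : ℕ) : IsSparse k (0 : EuclideanSpace ℝ (Fin N)) := by
  simp [IsSparse, supp]

theorem residual_eq (s t : EuclideanSpace ℝ (Fin N)) (n : EuclideanSpace ℝ (Fin M)) :
    toEuclideanLin A s + n - toEuclideanLin A t = toEuclideanLin A (s - t) + n := by
  rw [map_sub]
  abel

/-- The part of a sparse vector `t` missed by the support of a best term approximation of `b`. -/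
theorem IsBestApprox.norm_restr_compl_le {k : ℕ} {b p t : EuclideanSpace ℝ (Fin N)}
    (h : IsBestApprox k b p) (ht : IsSparse k t) : ‖restr (supp p)ᶜ t‖ ≤ 2 * ‖t - b‖ := by
  have h1 : ‖restr (supp p)ᶜ t‖ ≤ ‖restr (supp t \ supp p) t‖ :=
    norm_restr_le_norm_restr fun i hi h0 => by simpa using ⟨h0, by simpa using hi⟩
  have h2 := norm_sub_norm_le (restr (supp t \ supp p) t) (restr (supp t \ supp p) b)
  rw [← restr_sub] at h2
  have h3 := norm_restr_le (supp t \ supp p) (t - b)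
  have h4 := h.norm_restr_sdiff_le ht
  -- Off `supp t` the entries of `b` are pure error, so the energy of `b` that displaced indices of
  -- `t` is also at most `‖t - b‖`.
  have h5 : restr (supp p \ supp t) t = 0 := by
    ext i
    by_cases hi : t i = 0 <;> simp [hi]
  have h6 := norm_restr_le (supp p \ supp t) (t - b)
  rw [restr_sub, h5, zero_sub, norm_neg] at h6
  linarith

theorem IsIHTRun.norm_sub_le (hz : IsIHTRun A (toEuclideanLin A s + n) K z)
    (h : SatisfiesRIP A (3 * K) δ) (hδ : 0 ≤ δ) (hs : IsSparse K s) (l : ℕ) :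
    ‖s - z (l + 1)‖ ≤ 2 * δ * ‖s - z l‖ + 2 * √(1 + δ) * ‖n‖ := by
  have sp : ∀ l, IsSparse K (z l) := by
    rintro (_ | l)
    · rw [hz.1]
      exact isSparse_zero K
    · exact (hz.2 l).1
  set U := supp s ∪ supp (z l) ∪ supp (z (l + 1)) with hU
  have hcard : U.card ≤ 3 * K := by
    have h1 := Finset.card_union_le (supp s ∪ supp (z l)) (supp (z (l + 1)))
    have h2 := Finset.card_union_le (supp s) (supp (z l))
    have h3 : (supp s).card ≤ K := hs
    have h4 : (supp (z l)).card ≤ K := sp l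
    have h5 : (supp (z (l + 1))).card ≤ K := sp (l + 1)
    rw [hU]
    omega
  have hsU : supp s ⊆ U := fun i hi => by simp only [hU, Finset.mem_union, hi, true_or]
  have hzU : supp (z l) ⊆ U := fun i hi => by simp only [hU, Finset.mem_union, hi, true_or, or_true]
  have hzU' : supp (z (l + 1)) ⊆ U := fun i hi => by simp only [hU, Finset.mem_union, hi, or_true]
  have h1 := (hz.2 l).2 s hs
  have h2 := h.inner_proxy_sub_le (n := n) hδ hcard (supp_sub_subset hsU hzU)
    (supp_sub_subset hzU' hsU)
  rw [residual_eq] at h1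
  set g := toEuclideanLin Aᵀ (toEuclideanLin A (s - z l) + n) with hg
  -- Optimality against the competitor `s`, once squared and expanded, reads `‖z (l + 1) - s‖² ≤ 2
  -- ⟪g - (s - z l), z (l + 1) - s⟫`.
  have h3 : z l + g - z (l + 1) = (g - (s - z l)) - (z (l + 1) - s) := by abel
  have h4 : z l + g - s = g - (s - z l) := by abel
  rw [h3, h4, ← sq_le_sq₀ (norm_nonneg _) (norm_nonneg _), norm_sub_sq_real] at h1
  rw [norm_sub_rev s (z (l + 1))]
  rcases (norm_nonneg (z (l + 1) - s)).eq_or_lt with h0 | h0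
  · rw [← h0]
    positivity
  · refine le_of_mul_le_mul_right ?_ h0
    linarith

theorem IsCoSaMPRun.norm_sub_le (hz : IsCoSaMPRun A (toEuclideanLin A s + n) K z)
    (h : SatisfiesRIP A (4 * K) δ) (hδ : 0 ≤ δ) (hδ1 : δ < 1) (hs : IsSparse K s) (l : ℕ) :
    (1 - δ) * ‖s - z (l + 1)‖ ≤ 4 * δ * ‖s - z l‖ + 6 * √(1 + δ) * ‖n‖ := by
  have sp : ∀ l, IsSparse K (z l) := by
    rintro (_ | l)
    · rw [hz.1]
      exact isSparse_zero K
    · exact (hz.2 l).choose_spec.2.1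
  obtain ⟨w, hw, hb⟩ := hz.2 l
  rw [residual_eq] at hw
  set U := supp s ∪ (supp w ∪ supp (z l)) with hU
  have h3 : (supp s).card ≤ K := hs
  have h4 : (supp (z l)).card ≤ K := sp l
  have hcard : U.card ≤ 4 * K := by
    have h1 := Finset.card_union_le (supp s) (supp w ∪ supp (z l))
    have h2 := Finset.card_union_le (supp w) (supp (z l))
    have h5 : (supp w).card ≤ 2 * K := hw.1
    rw [hU]
    omega
  have hsU : supp s ⊆ U := fun i hi => by simp only [hU, Finset.mem_union, hi, true_or]
  have hzU : supp (z l) ⊆ U := fun i hi => by simp only [hU, Finset.mem_union, hi, or_true]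
  have hwU : supp w ⊆ U := fun i hi => by simp only [hU, Finset.mem_union, hi, true_or, or_true]
  have hqR : (supp (s - z l)).card ≤ 2 * K := by
    have h1 := Finset.card_le_card
      (supp_sub_subset (Finset.subset_union_left (s₂ := supp (z l)))
        (Finset.subset_union_right (s₁ := supp s)))
    have h2 := Finset.card_union_le (supp s) (supp (z l))
    omega
  have hqU := supp_sub_subset hsU hzU
  have h6 := h.norm_restr_sdiff_le hδ hcard hqU hqU hwU hqR hw
    fun i _ hi => by simpa only [mem_supp, ne_eq, not_not] using hi
  have h7 := h.norm_sub_lsOn_le (s := s) (n := n) (T := supp w ∪ supp (z l)) hδ hδ1 hcard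
  -- Outside the merged support `z l` vanishes, so `s` agrees there with `s - z l`.
  have h8 : ‖restr (supp w ∪ supp (z l))ᶜ s‖ ≤ ‖restr (supp (s - z l) \ supp w) (s - z l)‖ := by
    refine norm_restr_le_norm_restr fun i hi h0 => ?_
    simp only [Finset.mem_compl, Finset.mem_union, mem_supp, ne_eq, not_or, not_not] at hi
    simp [hi.1, hi.2, h0]
  have h9 := hb.2 s hs
  set b := lsOn A (supp w ∪ supp (z l)) (toEuclideanLin A s + n)
  have h10 := norm_sub_le_norm_sub_add_norm_sub s b (z (l + 1))
  rw [norm_sub_rev b s] at h9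
  -- Pruning at most doubles the error, as `s` is itself an admissible `K`-sparse competitor. Hence
  -- the constants `4 = 2 * 2` and `6 = 2 * (2 + 1)`.
  have h11 : (1 - δ) * ‖s - z (l + 1)‖ ≤ (1 - δ) * (2 * ‖s - b‖) := by
    have : 0 ≤ 1 - δ := by linarith
    gcongr
    linarith
  linarith

/-- The part of `s` missed by the support estimate contracts in each iteration. -/
theorem norm_restr_compl_le_of_subspacePursuit {S : Finset (Fin N)}
    {w p : EuclideanSpace ℝ (Fin N)} (h : SatisfiesRIP A (3 * K) δ) (hδ : 0 ≤ δ) (hδ1 : δ < 1)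
    (hs : IsSparse K s) (hS : S.card ≤ K)
    (hw : IsBestApprox K (toEuclideanLin Aᵀ (toEuclideanLin A s + n -
      toEuclideanLin A (lsOn A S (toEuclideanLin A s + n)))) w)
    (hp : IsBestApprox K (lsOn A (supp w ∪ S) (toEuclideanLin A s + n)) p) :
    (1 - δ) ^ 2 * ‖restr (supp p)ᶜ s‖ ≤
      2 * δ * (1 + δ) * ‖restr Sᶜ s‖ + 4 * (√(1 + δ) * ‖n‖) := by
  have h3 : (supp s).card ≤ K := hs
  have h5 : (supp w).card ≤ K := hw.1
  -- The least squares residual is orthogonal to the columns in `S`, so the proxy vanishes on `S`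
  -- and every selected index is new. Selected indices outside `supp s` are then zeros of both `s`
  -- and `v`, which is why `K` indices suffice where CoSaMP takes `2 * K`.
  have hwS : ∀ i ∈ supp w, i ∉ S := fun i hi hiS => by
    have h1 := hw.apply_eq hi
    rw [transpose_residual_lsOn_apply _ hiS] at h1
    exact mem_supp.1 hi h1.symm
  set U := supp s ∪ (supp w ∪ S) with hU
  have hcard : U.card ≤ 3 * K := by
    have h1 := Finset.card_union_le (supp s) (supp w ∪ S)
    have h2 := Finset.card_union_le (supp w) S
    rw [hU]
    omega
  have hsU : supp s ⊆ U := fun i hi => by simp only [hU, Finset.mem_union, hi, true_or]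
  have hSU : S ⊆ U := fun i hi => by simp only [hU, Finset.mem_union, hi, or_true]
  have hwU : supp w ⊆ U := fun i hi => by simp only [hU, Finset.mem_union, hi, true_or, or_true]
  have h1 := h.norm_sub_lsOn_le (s := s) (n := n) (T := S) hδ hδ1
    ((Finset.card_le_card (Finset.union_subset hsU hSU)).trans hcard)
  have hzS := supp_lsOn_subset (A := A) S (toEuclideanLin A s + n)
  rw [residual_eq] at hw
  set v := lsOn A S (toEuclideanLin A s + n)
  have h6 := h.norm_restr_sdiff_le hδ hcard (supp_sub_subset hsU (hzS.trans hSU)) hsU hwU h3 hw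
    fun i hi his => by
      have hs0 : s i = 0 := by simpa only [mem_supp, ne_eq, not_not] using his
      have hv0 : v i = 0 := supp_subset_iff.1 hzS i (hwS i hi)
      simp [hs0, hv0]
  have h8 : ‖restr (supp w ∪ S)ᶜ s‖ ≤ ‖restr (supp s \ supp w) (s - v)‖ := by
    refine norm_restr_le_norm_restr fun i hi h0 => ?_
    simp only [Finset.mem_compl, Finset.mem_union, not_or] at hi
    have hv0 : v i = 0 := supp_subset_iff.1 hzS i hi.2
    simp only [Finset.mem_sdiff, hi.1, mem_supp]
    simp [hv0, h0]
  have h9 := h.norm_restr_sub_lsOn_le (s := s) (n := n) (T := supp w ∪ S) hδ hcard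
  have h10 := hp.norm_restr_compl_le (t := restr (supp w ∪ S) s)
    (IsSparse.of_subset (supp_restr_subset_supp _ _) hs)
  have h11 : ‖restr (supp p)ᶜ s‖ ≤ ‖restr (supp p)ᶜ (restr (supp w ∪ S) s)‖ +
      ‖restr (supp w ∪ S)ᶜ s‖ := by
    have h12 := norm_sub_norm_le (restr (supp p)ᶜ s) (restr (supp p)ᶜ (restr (supp w ∪ S) s))
    rw [← restr_sub, sub_restr] at h12
    linarith [norm_restr_le (supp p)ᶜ (restr (supp w ∪ S)ᶜ s)]
  set ν := √(1 + δ) * ‖n‖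
  set d := ‖restr (supp w ∪ S) s - lsOn A (supp w ∪ S) (toEuclideanLin A s + n)‖
  set t := ‖restr (supp w ∪ S)ᶜ s‖
  have hδ' : 0 ≤ 1 - δ := by linarith
  have h12 : (1 - δ) * ‖restr (supp p)ᶜ s‖ ≤ (1 + δ) * t + 2 * ν := by
    have : (1 - δ) * ‖restr (supp p)ᶜ s‖ ≤ (1 - δ) * (2 * d + t) := by
      gcongr
      linarith
    linarith
  have h13 : (1 - δ) * t ≤ 2 * δ * ‖restr Sᶜ s‖ + 2 * ν := by
    have h14 : (1 - δ) * t ≤ (1 - δ) * (2 * (δ * ‖s - v‖ + ν)) := by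
      gcongr
      linarith
    have h15 := mul_le_mul_of_nonneg_left h1 hδ
    linarith
  -- In the combination the noise terms are `(1 + δ) * 2ν + (1 - δ) * 2ν = 4ν`.
  have h16 := mul_le_mul_of_nonneg_left h12 hδ'
  have h17 := mul_le_mul_of_nonneg_left h13 (by linarith : 0 ≤ 1 + δ)
  linarith

end Steps

/-! ### Convergence -/

/-- `F / (1 - C)` is the fixed point of `t ↦ C * t + F`, and the excess over it shrinks by `C` at
each step. -/
theorem le_pow_mul_add_of_le_mul_add {f : ℕ → ℝ} {C F : ℝ} (hC : 0 ≤ C) (hC1 : C < 1)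
    (h : ∀ l, f (l + 1) ≤ C * f l + F) (hF : 0 ≤ F) (l : ℕ) :
    f l ≤ C ^ l * f 0 + F / (1 - C) := by
  have h1 : 0 < 1 - C := by linarith
  have hq : F / (1 - C) = C * (F / (1 - C)) + F := by
    field_simp
    ring
  induction l with
  | zero =>
    have : 0 ≤ F / (1 - C) := by positivity
    simpa using this
  | succ l ih =>
    calc f (l + 1) ≤ C * f l + F := h l
      _ ≤ C * (C ^ l * f 0 + F / (1 - C)) + F := by gcongr
      _ = C ^ (l + 1) * f 0 + (C * (F / (1 - C)) + F) := by ring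
      _ = _ := by rw [← hq]

/-- Removes the square root from the noise terms of CoSaMP and SP, whose constants `D` are rational
in `δ`. -/
theorem sqrt_one_add_le {δ : ℝ} (hδ : 0 ≤ δ) : √(1 + δ) ≤ 1 + δ / 2 :=
  Real.sqrt_le_iff.2 ⟨by positivity, by nlinarith [sq_nonneg δ]⟩

theorem sqrt_eight_le : √8 ≤ 2.83 :=
  Real.sqrt_le_iff.2 ⟨by norm_num, by norm_num⟩

theorem two_le_sqrt_eight : 2 ≤ √8 :=
  Real.le_sqrt_of_sq_le (by norm_num)

/-! ### Contraction rates, thresholds and accumulated error of each algorithm -/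

namespace Pursuit

variable {δ : ℝ}

theorem C_nonneg (alg : Pursuit) (hδ : 0 ≤ δ) (hc : δ ≤ alg.c) : 0 ≤ alg.C δ := by
  cases alg <;> simp only [C, c] at *
  · positivity
  · have : 0 < 1 - δ := by linarith
    positivity
  · positivity

theorem CoSaMP_denom_pos (hδ : 0 ≤ δ) (hc : δ ≤ CoSaMP.c) : 0 < 1 - 6 * δ + δ ^ 2 := by
  simp only [c] at hc
  nlinarith

theorem SP_denom_pos (hδ : 0 ≤ δ) (hc : δ ≤ SP.c) : 0 < 1 - 5 * δ + δ ^ 2 - δ ^ 3 := by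
  simp only [c] at hc
  have h1 : δ ^ 2 * δ ≤ δ ^ 2 * 0.206 := by gcongr
  nlinarith

/-- Each `c` is the solution of `C δ = 1` rounded down to three decimals. For CoSaMP and SP the
numerator of `1 - C δ` is the polynomial of the preceding lemmas. -/
theorem C_lt_one (alg : Pursuit) (hδ : 0 ≤ δ) (hc : δ ≤ alg.c) : alg.C δ < 1 := by
  cases alg
  · have h := CoSaMP_denom_pos hδ hc
    simp only [C, c] at *
    have h1 : 0 < 1 - δ := by linarith
    rw [div_lt_one (by positivity)]
    linarith
  · have h := SP_denom_pos hδ hc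
    simp only [C, c] at *
    have h1 : 0 < 1 - δ := by linarith
    rw [div_lt_one (by positivity)]
    linarith
  · simp only [C, c] at *
    nlinarith [sqrt_eight_le]

theorem D_nonneg (alg : Pursuit) (hδ : 0 ≤ δ) (hc : δ ≤ alg.c) : 0 ≤ alg.D δ := by
  have hC := alg.C_lt_one hδ hc
  cases alg
  · have h := CoSaMP_denom_pos hδ hc
    simp only [D]
    positivity
  · have h := SP_denom_pos hδ hc
    simp only [D, c] at *
    have h1 : 0 < 1 - δ := by linarith
    have h2 : 1 - 6 * δ + 6 * δ ^ 2 - 2 * δ ^ 3 + δ ^ 4 =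
      (1 - 5 * δ + δ ^ 2 - δ ^ 3) * (1 - δ) := by ring
    have h3 : 5 - 4 * δ - 8 * δ ^ 2 - δ ^ 4 =
      (1 + δ) * (4 * (1 - δ) + (1 - 5 * δ + δ ^ 2 - δ ^ 3)) := by ring
    rw [h2, h3]
    positivity
  · simp only [C, D] at *
    have h1 : 0 < 1 - √8 * δ := by linarith
    positivity

theorem a_pos (alg : Pursuit) : 0 < alg.a := by
  cases alg <;> norm_num [a]

theorem c_lt_one (alg : Pursuit) : alg.c < 1 := by
  cases alg <;> norm_num [c]

variable {M N : ℕ} {A : Matrix (Fin M) (Fin N) ℝ} {K : ℕ}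
  {s : EuclideanSpace ℝ (Fin N)} {n : EuclideanSpace ℝ (Fin M)}
  {z : ℕ → EuclideanSpace ℝ (Fin N)}

theorem norm_sub_le_CoSaMP (hz : CoSaMP.IsRun A (toEuclideanLin A s + n) K z)
    (h : SatisfiesRIP A (CoSaMP.b * K) δ) (hδ : 0 ≤ δ) (hc : δ ≤ CoSaMP.c)
    (hs : IsSparse K s) (l : ℕ) :
    ‖s - z l‖ ≤ CoSaMP.a * CoSaMP.C δ ^ l * ‖s‖ + CoSaMP.D δ * ‖n‖ := by
  have hC := CoSaMP.C_nonneg hδ hc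
  have hC1 := CoSaMP.C_lt_one hδ hc
  have hd := CoSaMP_denom_pos hδ hc
  have hδ1 := hc.trans_lt CoSaMP.c_lt_one
  have h1 : 0 < 1 - δ := by linarith
  have hz' : IsCoSaMPRun A (toEuclideanLin A s + n) K z := hz
  have step : ∀ l, ‖s - z (l + 1)‖ ≤
      CoSaMP.C δ * ‖s - z l‖ + (6 + 2 * δ) / (1 - δ) ^ 2 * ‖n‖ := by
    intro l
    have h2 := hz'.norm_sub_le h hδ hδ1 hs l
    have h3 : (1 - δ) * √(1 + δ) ≤ (1 - δ) * (1 + δ / 2) := by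
      gcongr
      exact sqrt_one_add_le hδ
    simp only [C]
    rw [div_mul_eq_mul_div, div_mul_eq_mul_div, ← add_div, le_div_iff₀ (by positivity)]
    have h4 := mul_le_mul_of_nonneg_left h2 h1.le
    -- Chosen so that `6 * (1 + δ / 3)` is the numerator `6 + 2 * δ` of `D`.
    have h5 : (1 - δ) * √(1 + δ) * ‖n‖ ≤ (1 + δ / 3) * ‖n‖ := by
      gcongr
      nlinarith [sq_nonneg δ]
    have h6 : 0 ≤ δ * (δ * ‖s - z l‖) := by positivity
    linarith
  have h2 := le_pow_mul_add_of_le_mul_add (f := fun l => ‖s - z l‖) hC hC1 step (by positivity) l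
  have h3 : (6 + 2 * δ) / (1 - δ) ^ 2 * ‖n‖ / (1 - CoSaMP.C δ) = CoSaMP.D δ * ‖n‖ := by
    have h4 : 1 - CoSaMP.C δ = (1 - 6 * δ + δ ^ 2) / (1 - δ) ^ 2 := by
      simp only [C]
      field_simp
      ring
    rw [h4]
    simp only [D]
    field_simp
  beta_reduce at h2
  rw [h3, hz'.1, sub_zero] at h2
  simpa [a] using h2

theorem norm_sub_le_IHT (hz : IHT.IsRun A (toEuclideanLin A s + n) K z)
    (h : SatisfiesRIP A (IHT.b * K) δ) (hδ : 0 ≤ δ) (hc : δ ≤ IHT.c)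
    (hs : IsSparse K s) (l : ℕ) :
    ‖s - z l‖ ≤ IHT.a * IHT.C δ ^ l * ‖s‖ + IHT.D δ * ‖n‖ := by
  have hz' : IsIHTRun A (toEuclideanLin A s + n) K z := hz
  have step : ∀ l, ‖s - z (l + 1)‖ ≤ IHT.C δ * ‖s - z l‖ + 2 * √(1 + δ) * ‖n‖ := by
    intro l
    -- The rate obtained is `2 * δ`, which `√8 * δ` dominates.
    refine (hz'.norm_sub_le h hδ hs l).trans ?_
    simp only [C]
    gcongr
    exact two_le_sqrt_eight
  have h2 := le_pow_mul_add_of_le_mul_add (f := fun l => ‖s - z l‖) (IHT.C_nonneg hδ hc)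
    (IHT.C_lt_one hδ hc) step (by positivity) l
  beta_reduce at h2
  rw [hz'.1, sub_zero, mul_div_right_comm] at h2
  simpa [a, D, C] using h2

theorem norm_sub_le_SP (hz : SP.IsRun A (toEuclideanLin A s + n) K z)
    (h : SatisfiesRIP A (SP.b * K) δ) (hδ : 0 ≤ δ) (hc : δ ≤ SP.c)
    (hs : IsSparse K s) (l : ℕ) :
    ‖s - z l‖ ≤ SP.a * SP.C δ ^ l * ‖s‖ + SP.D δ * ‖n‖ := by
  have hC := SP.C_nonneg hδ hc
  have hC1 := SP.C_lt_one hδ hc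
  have hd := SP_denom_pos hδ hc
  have hδ1 := hc.trans_lt SP.c_lt_one
  have h1 : 0 < 1 - δ := by linarith
  obtain ⟨S, ⟨w₀, hw₀, hS₀⟩, hls, hstep⟩ := hz
  have hcard : ∀ l, (S l).card ≤ K := by
    rintro (_ | l)
    · rw [hS₀]
      exact hw₀.1
    · obtain ⟨w, p, -, hp, hSp⟩ := hstep l
      rw [hSp]
      exact hp.1
  set ν := √(1 + δ) * ‖n‖ with hν
  have hν0 : 0 ≤ ν := by positivity
  have step : ∀ l, ‖restr (S (l + 1))ᶜ s‖ ≤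
      SP.C δ * ‖restr (S l)ᶜ s‖ + 4 * ν / (1 - δ) ^ 2 := by
    intro l
    obtain ⟨w, p, hw, hp, hSp⟩ := hstep l
    rw [hls] at hw
    have h2 := norm_restr_compl_le_of_subspacePursuit h hδ hδ1 hs (hcard l) hw hp
    rw [hSp]
    -- The missed energy contracts at a rate better than `C` by a factor `1 - δ`.
    have h3 : (2 * δ * (1 + δ)) / (1 - δ) ^ 2 ≤ SP.C δ := by
      simp only [C]
      rw [div_le_div_iff₀ (by positivity) (by positivity)]
      have : (2 * δ * (1 + δ)) * (1 - δ) ^ 2 * (1 - δ) ≤ (2 * δ * (1 + δ)) * (1 - δ) ^ 2 * 1 := by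
        gcongr
        linarith
      linarith
    calc ‖restr (supp p)ᶜ s‖
        ≤ (2 * δ * (1 + δ) * ‖restr (S l)ᶜ s‖ + 4 * ν) / (1 - δ) ^ 2 := by
          rw [le_div_iff₀ (by positivity)]
          linarith
      _ = (2 * δ * (1 + δ)) / (1 - δ) ^ 2 * ‖restr (S l)ᶜ s‖ + 4 * ν / (1 - δ) ^ 2 := by ring
      _ ≤ _ := by gcongr
  have h2 := le_pow_mul_add_of_le_mul_add (f := fun l => ‖restr (S l)ᶜ s‖) hC hC1 step (by positivity) l
  have h3 : ‖restr (S 0)ᶜ s‖ ≤ ‖s‖ := norm_restr_le _ _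
  have h4 : (supp s ∪ S l).card ≤ 3 * K := by
    have h5 := Finset.card_union_le (supp s) (S l)
    have h6 : (supp s).card ≤ K := hs
    have h7 := hcard l
    omega
  have h5 : (1 - δ) * ‖s - z l‖ ≤ ‖restr (S l)ᶜ s‖ + ν := by
    rw [hls]
    exact SatisfiesRIP.norm_sub_lsOn_le h hδ hδ1 h4
  -- The value `1.26` bounds `1 / (1 - 0.206)`, the price of passing from missed energy to error.
  have h6 : 1 ≤ SP.a * (1 - δ) := by
    simp only [a, c] at *
    linarith
  have h7 : 1 - SP.C δ = (1 - 5 * δ + δ ^ 2 - δ ^ 3) / (1 - δ) ^ 3 := by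
    simp only [C]
    field_simp
    ring
  have h8 : 4 * ν / (1 - δ) ^ 2 / (1 - SP.C δ) + ν ≤ (1 - δ) * (SP.D δ * ‖n‖) := by
    have h9 : ν ≤ (1 + δ) * ‖n‖ := by
      rw [hν]
      gcongr
      linarith [sqrt_one_add_le hδ]
    have h10 : SP.D δ = (1 + δ) * (4 * (1 - δ) + (1 - 5 * δ + δ ^ 2 - δ ^ 3)) /
        ((1 - 5 * δ + δ ^ 2 - δ ^ 3) * (1 - δ)) := by
      simp only [D]
      congr 1 <;> ring
    have h11 : 4 * ν / (1 - δ) ^ 2 / (1 - SP.C δ) + ν =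
        (4 * (1 - δ) + (1 - 5 * δ + δ ^ 2 - δ ^ 3)) / (1 - 5 * δ + δ ^ 2 - δ ^ 3) * ν := by
      rw [h7]
      generalize 1 - 5 * δ + δ ^ 2 - δ ^ 3 = d at hd ⊢
      field_simp
    rw [h10, h11]
    calc _ ≤ (4 * (1 - δ) + (1 - 5 * δ + δ ^ 2 - δ ^ 3)) / (1 - 5 * δ + δ ^ 2 - δ ^ 3) *
          ((1 + δ) * ‖n‖) := by gcongr
      _ = _ := by field_simp
  refine le_of_mul_le_mul_left ?_ h1
  have h9 : 0 ≤ SP.C δ ^ l := pow_nonneg hC l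
  calc (1 - δ) * ‖s - z l‖ ≤ SP.C δ ^ l * ‖restr (S 0)ᶜ s‖ +
        (4 * ν / (1 - δ) ^ 2 / (1 - SP.C δ) + ν) := by linarith
    _ ≤ SP.C δ ^ l * ‖s‖ + (1 - δ) * (SP.D δ * ‖n‖) := by gcongr
    _ ≤ (SP.a * (1 - δ)) * (SP.C δ ^ l * ‖s‖) + (1 - δ) * (SP.D δ * ‖n‖) := by
        have := mul_le_mul_of_nonneg_right h6 (mul_nonneg h9 (norm_nonneg s))
        linarith
    _ = _ := by ring

/-- Recovery from the noisy measurements `A s + n`. -/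
theorem norm_sub_le (alg : Pursuit) (hz : alg.IsRun A (toEuclideanLin A s + n) K z)
    (h : SatisfiesRIP A (alg.b * K) δ) (hδ : 0 ≤ δ) (hc : δ ≤ alg.c)
    (hs : IsSparse K s) (l : ℕ) :
    ‖s - z l‖ ≤ alg.a * alg.C δ ^ l * ‖s‖ + alg.D δ * ‖n‖ := by
  cases alg
  · exact norm_sub_le_CoSaMP hz h hδ hc hs l
  · exact norm_sub_le_SP hz h hδ hc hs l
  · exact norm_sub_le_IHT hz h hδ hc hs l

end Pursuit

/-! ### Norms of column submatrices and of the change of basis -/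

section ColNorm

variable {M N K : ℕ} {A : Matrix (Fin M) (Fin N) ℝ}

/-- Since `K ≤ N`, the support of `s` extends to exactly `K` columns, as the supremum requires. -/
theorem norm_toEuclideanLin_le_colNorm (hKN : K ≤ N) {s : EuclideanSpace ℝ (Fin N)}
    (hs : IsSparse K s) : ‖toEuclideanLin A s‖ ≤ colNorm K A * ‖s‖ := by
  obtain ⟨S, hsS, hS⟩ := Finset.exists_superset_card_eq hs (by simpa using hKN)
  have h1 : toEuclideanLin A s = WithLp.toLp 2 (cols A S *ᵥ fun i : S => s i) := by
    rw [← mulVec_eq_cols_mulVec hsS]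
    rfl
  have h2 : ‖(WithLp.toLp 2 fun i : S => s i : EuclideanSpace ℝ S)‖ ≤ ‖s‖ := by
    rw [← sq_le_sq₀ (norm_nonneg _) (norm_nonneg _), EuclideanSpace.real_norm_sq_eq,
      EuclideanSpace.real_norm_sq_eq]
    change ∑ i : S, s i ^ 2 ≤ _
    rw [Finset.sum_coe_sort S fun i => s i ^ 2]
    exact Finset.sum_le_sum_of_subset_of_nonneg (Finset.subset_univ S) fun i _ _ => sq_nonneg _
  rw [h1]
  have h3 := Matrix.l2_opNorm_mulVec (cols A S) (WithLp.toLp 2 fun i : S => s i)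
  have h4 : ‖cols A S‖ ≤ colNorm K A :=
    le_ciSup (f := fun S : {S : Finset (Fin N) // S.card = K} => ‖cols A S.1‖)
      (Set.finite_range _).bddAbove ⟨S, hS⟩
  exact h3.trans (mul_le_mul h4 h2 (norm_nonneg _) ((norm_nonneg _).trans h4))

theorem colNorm_nonneg : 0 ≤ colNorm K A :=
  Real.iSup_nonneg fun _ => norm_nonneg _

/-- A coefficient vector on `K` columns, extended by zero, is a `K`-sparse vector of the same norm.
-/
theorem colNorm_le_sqrt (hKN : K ≤ N) : colNorm K A ≤ √(1 + ric A K) := by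
  have hr := (ric_isLeast A K).1
  obtain ⟨S₀, -, hS₀⟩ := Finset.exists_superset_card_eq (s := (∅ : Finset (Fin N))) (n := K)
    (by simp) (by simpa using hKN)
  have : Nonempty {S : Finset (Fin N) // S.card = K} := ⟨⟨S₀, hS₀⟩⟩
  refine ciSup_le fun S => ?_
  rw [Matrix.l2_opNorm_def]
  refine ContinuousLinearMap.opNorm_le_bound _ (Real.sqrt_nonneg _) fun v => ?_
  set u : EuclideanSpace ℝ (Fin N) := WithLp.toLp 2 fun i => if h : i ∈ S.1 then v ⟨i, h⟩ else 0
    with hu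
  have huS : supp u ⊆ S.1 := supp_subset_iff.2 fun i hi => by simp [hu, hi]
  have h1 := SatisfiesRIP.norm_le hr.2 hr.1 (IsSparse.of_subset huS S.2.le)
  have h2 : (fun i : S.1 => u i) = v.ofLp := by
    ext i
    simp [hu]
  have h3 : toEuclideanLin A u = WithLp.toLp 2 (cols A S.1 *ᵥ v.ofLp) := by
    rw [← h2, ← mulVec_eq_cols_mulVec huS]
    rfl
  have h4 : ‖u‖ = ‖v‖ := by
    rw [← sq_eq_sq₀ (norm_nonneg _) (norm_nonneg _), EuclideanSpace.real_norm_sq_eq,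
      EuclideanSpace.real_norm_sq_eq, ← h2, Finset.sum_coe_sort S.1 fun i => u i ^ 2]
    exact (Finset.sum_subset (Finset.subset_univ S.1) fun i _ hi => by
      simp [supp_subset_iff.1 huS i hi]).symm
  rw [h3, h4] at h1
  exact h1

theorem norm_le_norm_inv_mul {Ψ : Matrix (Fin N) (Fin N) ℝ} (hΨ : IsUnit Ψ.det)
    (s : EuclideanSpace ℝ (Fin N)) : ‖s‖ ≤ ‖Ψ⁻¹‖ * ‖toEuclideanLin Ψ s‖ := by
  have h := Matrix.l2_opNorm_mulVec Ψ⁻¹ (toEuclideanLin Ψ s)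
  have h1 : Ψ⁻¹ *ᵥ (toEuclideanLin Ψ s).ofLp = s.ofLp := by
    change Ψ⁻¹ *ᵥ (Ψ *ᵥ s.ofLp) = s.ofLp
    rw [Matrix.mulVec_mulVec, Matrix.nonsing_inv_mul _ hΨ, Matrix.one_mulVec]
  rwa [h1] at h

end ColNorm

end Greedy

/-! ### The main theorem -/

open Greedy

theorem theorem3 (alg : Pursuit) {M N K : ℕ} (hK : 1 ≤ K) (hKN : K ≤ N)
    (Φ Δ : Matrix (Fin M) (Fin N) ℝ) (Ψ : Matrix (Fin N) (Fin N) ℝ) (hΨ : IsUnit Ψ.det)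
    (s x : EuclideanSpace ℝ (Fin N)) (y e : EuclideanSpace ℝ (Fin M))
    (hs : IsSparse K s) (hx : x = Matrix.toEuclideanLin Ψ s)
    (hy : y = Matrix.toEuclideanLin Φ x) (hy0 : y ≠ 0)
    (A E A' : Matrix (Fin M) (Fin N) ℝ)
    (hA : A = Φ * Ψ) (hE : E = Δ * Ψ) (hA' : A' = (Φ + Δ) * Ψ)
    (δ δ' εy εA : ℝ) (hδ : δ = ric A K) (hδ' : δ' = ric A' (alg.b * K))
    (hεy : εy = ‖e‖ / ‖y‖) (hεA : εA = colNorm K E / colNorm K A)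
    (hRIP : δ' ≤ alg.c)
    (z : ℕ → EuclideanSpace ℝ (Fin N)) (hz : alg.IsRun A' (y + e) K z) :
    (∀ l : ℕ, ‖x - Matrix.toEuclideanLin Ψ (z l)‖ / ‖x‖ ≤
      condNumber Ψ * (alg.a * alg.C δ' ^ l + alg.D δ' * √(1 + δ) * (εy + εA))) ∧
    (0 < εy + εA → ∀ l : ℕ, (alg.C δ' = 0 → 1 ≤ l) →
      ⌈Real.logb (alg.C δ') ((εy + εA) / alg.a)⌉ ≤ (l : ℤ) →
      ‖x - Matrix.toEuclideanLin Ψ (z l)‖ / ‖x‖ ≤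
        condNumber Ψ * (alg.D δ' * √(1 + δ) + 1) * (εy + εA)) := by
  have hyA : y = toEuclideanLin A s := by
    rw [hy, hx, hA]
    ext i
    change (Φ *ᵥ (Ψ *ᵥ s.ofLp)) i = ((Φ * Ψ) *ᵥ s.ofLp) i
    rw [Matrix.mulVec_mulVec]
  have hs0 : 0 < ‖s‖ := norm_pos_iff.2 fun h => hy0 (by rw [hyA, h, map_zero])
  have hx0 : 0 < ‖x‖ := norm_pos_iff.2 fun h => hy0 (by rw [hy, h, map_zero])
  have hy0' : 0 < ‖y‖ := norm_pos_iff.2 hy0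
  obtain ⟨hδ0, hRIPA⟩ := (ric_isLeast A K).1
  obtain ⟨hδ0', hRIPA'⟩ := (ric_isLeast A' (alg.b * K)).1
  rw [← hδ] at hδ0 hRIPA
  rw [← hδ'] at hδ0' hRIPA'
  -- As `y = A s` is nonzero, the quotient defining `εA` has a nonzero denominator.
  have hcA : 0 < colNorm K A := by
    have h := norm_toEuclideanLin_le_colNorm (A := A) hKN hs
    rw [← hyA] at h
    exact pos_of_mul_pos_left (hy0'.trans_le h) hs0.le
  have hnoise : ‖e - toEuclideanLin E s‖ ≤ √(1 + δ) * (εy + εA) * ‖s‖ := by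
    have h1 : ‖e‖ ≤ εy * (√(1 + δ) * ‖s‖) := by
      calc ‖e‖ = εy * ‖y‖ := by rw [hεy, div_mul_cancel₀ _ hy0'.ne']
        _ ≤ _ := by
          have : 0 ≤ εy := by rw [hεy]; positivity
          rw [hyA]
          gcongr
          exact hRIPA.norm_le hδ0 hs
    have h2 : ‖toEuclideanLin E s‖ ≤ εA * √(1 + δ) * ‖s‖ := by
      refine (norm_toEuclideanLin_le_colNorm hKN hs).trans ?_
      gcongr
      calc colNorm K E = εA * colNorm K A := by rw [hεA, div_mul_cancel₀ _ hcA.ne']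
        _ ≤ _ := by
          have : 0 ≤ εA := by rw [hεA]; exact div_nonneg colNorm_nonneg hcA.le
          gcongr
          rw [hδ]
          exact colNorm_le_sqrt hKN
    have h3 := norm_sub_le e (toEuclideanLin E s)
    linarith
  have hmeas : y + e = toEuclideanLin A' s + (e - toEuclideanLin E s) := by
    have h : A' = A + E := by rw [hA', hA, hE, Matrix.add_mul]
    rw [hyA, h, map_add, LinearMap.add_apply]
    abel
  rw [hmeas] at hz
  have hC0 := alg.C_nonneg hδ0' hRIP
  have hD0 := alg.D_nonneg hδ0' hRIP
  have hκ : 0 ≤ condNumber Ψ := mul_nonneg (norm_nonneg _) (norm_nonneg _)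
  have main : ∀ l : ℕ, ‖x - toEuclideanLin Ψ (z l)‖ / ‖x‖ ≤
      condNumber Ψ * (alg.a * alg.C δ' ^ l + alg.D δ' * √(1 + δ) * (εy + εA)) := by
    intro l
    have h1 := alg.norm_sub_le hz hRIPA' hδ0' hRIP hs l
    have h2 : ‖s - z l‖ ≤
        (alg.a * alg.C δ' ^ l + alg.D δ' * √(1 + δ) * (εy + εA)) * ‖s‖ := by
      have := mul_le_mul_of_nonneg_left hnoise hD0
      linarith
    have h3 : ‖x - toEuclideanLin Ψ (z l)‖ ≤ ‖Ψ‖ * ‖s - z l‖ := by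
      rw [hx, ← map_sub]
      exact Matrix.l2_opNorm_mulVec Ψ (s - z l)
    have h4 : ‖s‖ ≤ ‖Ψ⁻¹‖ * ‖x‖ := by
      rw [hx]
      exact norm_le_norm_inv_mul hΨ s
    set B := alg.a * alg.C δ' ^ l + alg.D δ' * √(1 + δ) * (εy + εA)
    have hB : 0 ≤ B := nonneg_of_mul_nonneg_left ((norm_nonneg _).trans h2) hs0
    rw [div_le_iff₀ hx0]
    calc _ ≤ ‖Ψ‖ * (B * (‖Ψ⁻¹‖ * ‖x‖)) := h3.trans (by gcongr; exact h2.trans (by gcongr))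
      _ = _ := by rw [condNumber]; ring
  refine ⟨main, fun hε l hl0 hl => (main l).trans ?_⟩
  rw [mul_assoc (condNumber Ψ)]
  gcongr
  -- The bound on `l` is where the geometric term drops to the noise level; the logarithm has base
  -- below 1, so it reverses the inequality.
  have h5 : alg.a * alg.C δ' ^ l ≤ εy + εA := by
    rw [← le_div_iff₀' alg.a_pos]
    have hq : 0 < (εy + εA) / alg.a := div_pos hε alg.a_pos
    -- For `C = 0` the value of `Real.logb` is the default 0 and the ceiling condition is void; `1 ≤
    -- l` is what makes `0 ^ l` vanish.
    rcases hC0.eq_or_lt with h0 | h0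
    · rw [← h0, zero_pow (by have := hl0 h0.symm; omega)]
      exact hq.le
    · have h6 : Real.logb (alg.C δ') ((εy + εA) / alg.a) ≤ l := by
        exact_mod_cast Int.ceil_le.1 hl
      rw [Real.logb_le_iff_le_rpow_of_base_lt_one h0 (alg.C_lt_one hδ0' hRIP) hq,
        Real.rpow_natCast] at h6
      exact h6
  linarith
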